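/- Let $\lambda$ be Lebesgue measure on $[0,1]$ and let $r:[0,1]\to[1,\infty)$ be Borel measurable. Write $r^+=\operatorname{ess\,sup} r$, $r^-=\operatorname{ess\,inf} r$ and $\Omega_1=r^{-1}(\{1\})$. For such an exponent $r$, $L^{r(\cdot)}$ denotes the space of (a.e.-classes of) measurable functions $f:[0,1]\to\mathbb R$ with $\rho(f/\eta)<\infty$ for some $\eta>0$, where $\rho(f)=\int_0^1|f(x)|^{r(x)}\,dx$, equipped with the Luxemburg norm $\|f\|_{r(\cdot)}=\inf\{\eta>0:\rho(f/\eta)\le 1\}$. A subset of a normed space is relatively weakly compact if its closure in the weak topology is weakly compact; a linear operator is weakly compact if it sends the closed unit ball to a relatively weakly compact set. Theorem 4.5. Assume $r^+<\infty$ and $\lambda(\Omega_1)=0$. Let $\varphi:[0,1]\to[0,1]$ be Borel measurable and non-singular ($\lambda(E)=0$ implies $\lambda(\varphi^{-1}(E))=0$ for Borel $E$), put $r_\varphi=r\circ\varphi$, and let $u_\varphi=d(\lambda\circ\varphi^{-1})/d\lambda$. Suppose that $T_\varphi f=f\circ\varphi$ maps $L^{r(\cdot)}$ into $L^{r_\varphi(\cdot)}$.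 Then: (w1) $T_\varphi:L^{r(\cdot)}\to L^{r_\varphi(\cdot)}$ maps relatively weakly compact sets to relatively weakly compact sets. (w2) Let $v_\varphi=u_\varphi^{1/r(\cdot)}$. The multiplication operator $M_{v_\varphi}f=v_\varphi f$ maps $L^{r(\cdot)}$ into itself, and $T_\varphi$ is weakly compact if and only if $M_{v_\varphi}:L^{r(\cdot)}\to L^{r(\cdot)}$ is weakly compact. (w3) If $r^-=1$ and $\operatorname{ess\,inf}_{[0,1]\setminus\Omega_1}u_\varphi>0$, then $T_\varphi$ is not weakly compact. -/

import Mathlib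

open MeasureTheory
open scoped ENNReal

namespace VariableLebesgue

/-- The class `𝒫(X)` of variable exponents: measurable functions `X → [1, ∞)`. -/
structure VarExponent (X : Type*) [MeasurableSpace X] where
  toFun : X → ℝ
  measurable' : Measurable toFun
  one_le' : ∀ x, 1 ≤ toFun x

instance {X : Type*} [MeasurableSpace X] : CoeFun (VarExponent X) (fun _ => X → ℝ) :=
  ⟨VarExponent.toFun⟩

/-- The exponent `p_φ = p ∘ φ`. -/
def VarExponent.comp {X : Type*} [MeasurableSpace X] (p : VarExponent X) {φ : X → X}
    (hφ : Measurable φ) : VarExponent X where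
  toFun := fun x => p (φ x)
  measurable' := p.measurable'.comp hφ
  one_le' := fun x => p.one_le' (φ x)

/-- The number `p⁺`, the essential supremum of `p`. -/
noncomputable def VarExponent.upper {X : Type*} [MeasurableSpace X] (p : VarExponent X)
    (μ : Measure X) : ℝ≥0∞ :=
  essSup (fun x => ENNReal.ofReal (p x)) μ

/-- The number `p⁻`, the essential infimum of `p`. -/
noncomputable def VarExponent.lower {X : Type*} [MeasurableSpace X] (p : VarExponent X)
    (μ : Measure X) : ℝ≥0∞ :=
  essInf (fun x => ENNReal.ofReal (p x)) μ

/-- The set `Ω₁ = p⁻¹({1})`. -/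
def VarExponent.omegaOne {X : Type*} [MeasurableSpace X] (p : VarExponent X) : Set X :=
  {x | p x = 1}

section Space

variable {X : Type*} [MeasurableSpace X]

/-- The modular `ρ(f) = ∫ |f(x)| ^ p(x) dμ(x)`, with values in `[0, ∞]`. -/
noncomputable def modular (p : VarExponent X) (μ : Measure X) (f : X → ℝ) : ℝ≥0∞ :=
  ∫⁻ x, ‖f x‖ₑ ^ (p x) ∂μ

theorem modular_congr (p : VarExponent X) {μ : Measure X} {f g : X → ℝ} (h : f =ᵐ[μ] g) :
    modular p μ f = modular p μ g := by
  refine lintegral_congr_ae ?_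
  filter_upwards [h] with x hx
  rw [hx]

theorem modular_convex (p : VarExponent X) {μ : Measure X} {f g : X → ℝ}
    (hf : AEMeasurable f μ) {a b : ℝ} (ha : 0 < a) (hb : 0 < b) :
    modular p μ (fun x => (f x + g x) / (a + b)) ≤
      ENNReal.ofReal (a / (a + b)) * modular p μ (fun x => f x / a) +
      ENNReal.ofReal (b / (a + b)) * modular p μ (fun x => g x / b) := by
  unfold modular
  have hmeas : AEMeasurable (fun x => ‖f x / a‖ₑ ^ (p x)) μ :=
    (hf.div_const a).enorm.pow p.measurable'.aemeasurable
  rw [← lintegral_const_mul' _ _ ENNReal.ofReal_ne_top,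
    ← lintegral_const_mul' _ _ ENNReal.ofReal_ne_top,
    ← lintegral_add_left' (hmeas.const_mul _)]
  refine lintegral_mono fun x => ?_
  have hab : 0 < a + b := add_pos ha hb
  have hw : ENNReal.ofReal (a / (a + b)) + ENNReal.ofReal (b / (a + b)) = 1 := by
    rw [← ENNReal.ofReal_add (by positivity) (by positivity), ← add_div, div_self hab.ne',
      ENNReal.ofReal_one]
  refine le_trans ?_ (ENNReal.rpow_arith_mean_le_arith_mean2_rpow _ _ _ _ hw (p.one_le' x))
  refine ENNReal.rpow_le_rpow ?_ (le_trans zero_le_one (p.one_le' x))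
  have h1 : (f x + g x) / (a + b) = a / (a + b) * (f x / a) + b / (a + b) * (g x / b) := by
    field_simp
  change ‖(f x + g x) / (a + b)‖ₑ ≤
    ENNReal.ofReal (a / (a + b)) * ‖f x / a‖ₑ + ENNReal.ofReal (b / (a + b)) * ‖g x / b‖ₑ
  rw [h1]
  refine (enorm_add_le _ _).trans (le_of_eq ?_)
  rw [enorm_mul, enorm_mul, Real.enorm_of_nonneg (by positivity : 0 ≤ a / (a + b)),
    Real.enorm_of_nonneg (by positivity : 0 ≤ b / (a + b))]

theorem modular_zero (p : VarExponent X) (μ : Measure X) :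
    modular p μ (fun _ => 0) = 0 := by
  unfold modular
  have : ∀ x, ‖(0 : ℝ)‖ₑ ^ (p x) = 0 := fun x => by
    rw [enorm_zero, ENNReal.zero_rpow_of_pos (lt_of_lt_of_le zero_lt_one (p.one_le' x))]
  simp only [this, lintegral_zero]

theorem modular_div_le (p : VarExponent X) {μ : Measure X} {f : X → ℝ}
    (hf : AEMeasurable f μ) {a c : ℝ} (ha : 0 < a) (hac : a < c) :
    modular p μ (fun x => f x / c) ≤
      ENNReal.ofReal (a / c) * modular p μ (fun x => f x / a) := by
  have h := modular_convex p (g := fun _ => 0) hf ha (sub_pos.2 hac)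
  simpa [modular_zero] using h

variable (p : VarExponent X) (μ : Measure X)

/-- The set of the `η > 0` with `ρ(f / η) ≤ 1`. -/
def luxSet (f : X → ℝ) : Set ℝ :=
  {η | 0 < η ∧ modular p μ (fun x => f x / η) ≤ 1}

/-- The Luxemburg-Nakano norm `inf {η > 0 : ρ(f / η) ≤ 1}`. -/
noncomputable def luxNorm (f : X → ℝ) : ℝ := sInf (luxSet p μ f)

variable {p μ}

theorem luxSet_congr {f g : X → ℝ} (h : f =ᵐ[μ] g) : luxSet p μ f = luxSet p μ g := by
  ext η
  have : modular p μ (fun x => f x / η) = modular p μ (fun x => g x / η) :=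
    modular_congr p (h.mono fun x hx => by simp only [hx])
  simp [luxSet, this]

theorem luxSet_bddBelow (f : X → ℝ) : BddBelow (luxSet p μ f) := ⟨0, fun _ h => h.1.le⟩

theorem luxNorm_nonneg (f : X → ℝ) : 0 ≤ luxNorm p μ f := Real.sInf_nonneg fun _ h => h.1.le

theorem luxSet_nonempty {f : X → ℝ} (hf : AEMeasurable f μ)
    (h : ∃ η : ℝ, 0 < η ∧ modular p μ (fun x => f x / η) < ∞) : (luxSet p μ f).Nonempty := by
  obtain ⟨η, hη, hfin⟩ := h
  set m := (modular p μ (fun x => f x / η)).toReal with hm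
  have hm0 : 0 ≤ m := ENNReal.toReal_nonneg
  have hlt : η < η * (m + 2) := by nlinarith
  refine ⟨η * (m + 2), by positivity, (modular_div_le p hf hη hlt).trans ?_⟩
  rw [← ENNReal.ofReal_toReal hfin.ne, ← hm, ← ENNReal.ofReal_mul (by positivity)]
  refine ENNReal.ofReal_le_one.2 ?_
  have : η / (η * (m + 2)) * m = m / (m + 2) := by field_simp
  rw [this, div_le_one (by positivity)]
  linarith

theorem luxSet_of_lt {f : X → ℝ} (hf : AEMeasurable f μ) (hne : (luxSet p μ f).Nonempty) {c : ℝ}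
    (hc : luxNorm p μ f < c) : c ∈ luxSet p μ f := by
  obtain ⟨a, ha, hac⟩ := (csInf_lt_iff (luxSet_bddBelow f) hne).1 hc
  have hc0 : 0 < c := ha.1.trans hac
  refine ⟨hc0, (modular_div_le p hf ha.1 hac).trans ?_⟩
  calc _ ≤ (1 : ℝ≥0∞) * 1 :=
        mul_le_mul' (ENNReal.ofReal_le_one.2 ((div_le_one hc0).2 hac.le)) ha.2
    _ = 1 := one_mul 1

theorem luxSet_add {f g : X → ℝ} (hf : AEMeasurable f μ) {a b : ℝ} (ha : a ∈ luxSet p μ f)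
    (hb : b ∈ luxSet p μ g) : a + b ∈ luxSet p μ (fun x => f x + g x) := by
  have hab : 0 < a + b := add_pos ha.1 hb.1
  refine ⟨hab, (modular_convex p hf ha.1 hb.1).trans ?_⟩
  calc _ ≤ ENNReal.ofReal (a / (a + b)) * 1 + ENNReal.ofReal (b / (a + b)) * 1 :=
        add_le_add (mul_le_mul' le_rfl ha.2) (mul_le_mul' le_rfl hb.2)
    _ = 1 := by
        rw [mul_one, mul_one,
          ← ENNReal.ofReal_add (div_nonneg ha.1.le hab.le) (div_nonneg hb.1.le hab.le), ← add_div,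
          div_self hab.ne', ENNReal.ofReal_one]

theorem modular_smul_div (f : X → ℝ) {c η : ℝ} (hc : c ≠ 0) :
    modular p μ (fun x => c * f x / (|c| * η)) = modular p μ (fun x => f x / η) := by
  unfold modular
  refine lintegral_congr fun x => ?_
  congr 1
  rw [← enorm_norm, ← enorm_norm (f x / η)]
  congr 1
  have : |c| ≠ 0 := abs_ne_zero.2 hc
  simp only [Real.norm_eq_abs, abs_div, abs_mul, abs_abs]
  rw [mul_div_mul_left _ _ this]

theorem luxSet_smul {f : X → ℝ} {c a : ℝ} (hc : c ≠ 0) (ha : a ∈ luxSet p μ f) :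
    |c| * a ∈ luxSet p μ (fun x => c * f x) :=
  ⟨mul_pos (abs_pos.2 hc) ha.1, by rw [modular_smul_div f hc]; exact ha.2⟩

theorem luxNorm_smul_le {f : X → ℝ} (hne : (luxSet p μ f).Nonempty) {c : ℝ} (hc : c ≠ 0) :
    luxNorm p μ (fun x => c * f x) ≤ |c| * luxNorm p μ f := by
  have hc' : 0 < |c| := abs_pos.2 hc
  rw [mul_comm, ← div_le_iff₀ hc']
  refine le_csInf hne fun a ha => ?_
  rw [div_le_iff₀ hc', mul_comm]
  exact csInf_le (luxSet_bddBelow _) (luxSet_smul hc ha)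

theorem luxNorm_add_le {f g : X → ℝ} (hf : AEMeasurable f μ) (hg : AEMeasurable g μ)
    (hnf : (luxSet p μ f).Nonempty) (hng : (luxSet p μ g).Nonempty) :
    luxNorm p μ (fun x => f x + g x) ≤ luxNorm p μ f + luxNorm p μ g := by
  refine le_of_forall_pos_le_add fun ε hε => ?_
  have h1 := luxSet_of_lt hf hnf (show luxNorm p μ f < luxNorm p μ f + ε / 2 by linarith)
  have h2 := luxSet_of_lt hg hng (show luxNorm p μ g < luxNorm p μ g + ε / 2 by linarith)
  have h3 := csInf_le (luxSet_bddBelow _) (luxSet_add hf h1 h2)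
  unfold luxNorm at *
  linarith

theorem ae_eq_zero_of_luxNorm {f : X → ℝ} (hf : AEMeasurable f μ)
    (hne : (luxSet p μ f).Nonempty) (h : luxNorm p μ f = 0) : f =ᵐ[μ] 0 := by
  have hall : ∀ c : ℝ, 0 < c → c ∈ luxSet p μ f := fun c hc => luxSet_of_lt hf hne (h ▸ hc)
  have hz : modular p μ (fun x => f x / 1) = 0 := by
    refine le_antisymm (le_of_forall_gt fun ε hε => ?_) (zero_le)
    obtain ⟨δ, hδ, hδε⟩ : ∃ δ : ℝ, 0 < δ ∧ ENNReal.ofReal δ < ε := by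
      obtain ⟨q, hq0, hq⟩ := ENNReal.lt_iff_exists_real_btwn.1 hε
      exact ⟨q, by simpa using hq.1, hq.2⟩
    have hd : 0 < min δ (1 / 2) := lt_min hδ (by norm_num)
    have hd1 : min δ (1 / 2) < (1 : ℝ) := (min_le_right _ _).trans_lt (by norm_num)
    calc modular p μ (fun x => f x / 1)
        ≤ ENNReal.ofReal (min δ (1 / 2) / 1) * modular p μ (fun x => f x / min δ (1 / 2)) :=
          modular_div_le p hf hd hd1
      _ ≤ ENNReal.ofReal δ * 1 :=
          mul_le_mul' (ENNReal.ofReal_le_ofReal (by rw [div_one]; exact min_le_left _ _))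
            (hall _ hd).2
      _ < ε := by rwa [mul_one]
  unfold modular at hz
  have hmeas : AEMeasurable (fun x => ‖f x / 1‖ₑ ^ (p x)) μ :=
    (hf.div_const 1).enorm.pow p.measurable'.aemeasurable
  rw [lintegral_eq_zero_iff' hmeas] at hz
  filter_upwards [hz] with x hx
  have hp : 0 < p x := lt_of_lt_of_le zero_lt_one (p.one_le' x)
  simpa [hp, hp.not_gt] using hx

variable (p μ)

/-- `L^{p(·)}(X)` as a space of classes of measurable functions: those `f` with
`ρ(f / η) < ∞` for some `η > 0`. -/
def varLp : Submodule ℝ (X →ₘ[μ] ℝ) where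
  carrier := {f | ∃ η : ℝ, 0 < η ∧ modular p μ (fun x => f x / η) < ∞}
  zero_mem' := ⟨1, one_pos, by
    have : modular p μ (fun x => (0 : X →ₘ[μ] ℝ) x / 1) = modular p μ (fun _ => 0) :=
      modular_congr p (AEEqFun.coeFn_zero.mono fun x hx => by
        beta_reduce; rw [hx, Pi.zero_apply, zero_div])
    rw [this, modular_zero]
    exact ENNReal.zero_lt_top⟩
  add_mem' := by
    rintro f g ⟨a, ha, hfa⟩ ⟨b, hb, hgb⟩
    refine ⟨a + b, add_pos ha hb, ?_⟩
    have : modular p μ (fun x => (f + g : X →ₘ[μ] ℝ) x / (a + b)) =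
        modular p μ (fun x => (f x + g x) / (a + b)) :=
      modular_congr p ((AEEqFun.coeFn_add f g).mono fun x hx => by simp [hx])
    rw [this]
    exact (modular_convex p f.aemeasurable ha hb).trans_lt (ENNReal.add_lt_top.2
      ⟨ENNReal.mul_lt_top ENNReal.ofReal_lt_top hfa, ENNReal.mul_lt_top ENNReal.ofReal_lt_top hgb⟩)
  smul_mem' := by
    rintro c f ⟨a, ha, hfa⟩
    by_cases hc : c = 0
    · refine ⟨1, one_pos, ?_⟩
      have : modular p μ (fun x => (c • f : X →ₘ[μ] ℝ) x / 1) = modular p μ (fun _ => 0) :=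
        modular_congr p ((AEEqFun.coeFn_smul c f).mono fun x hx => by
          beta_reduce; rw [hx, Pi.smul_apply, hc, zero_smul, zero_div])
      rw [this, modular_zero]
      exact ENNReal.zero_lt_top
    · refine ⟨|c| * a, mul_pos (abs_pos.2 hc) ha, ?_⟩
      have : modular p μ (fun x => (c • f : X →ₘ[μ] ℝ) x / (|c| * a)) =
          modular p μ (fun x => c * f x / (|c| * a)) :=
        modular_congr p ((AEEqFun.coeFn_smul c f).mono fun x hx => by simp [hx])
      rw [this, modular_smul_div _ hc]
      exact hfa

noncomputable instance : Norm (varLp p μ) := ⟨fun f => luxNorm p μ (f : X →ₘ[μ] ℝ)⟩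

variable {p μ}

theorem varLp_norm_def (f : varLp p μ) : ‖f‖ = luxNorm p μ (f : X →ₘ[μ] ℝ) := rfl

theorem varLp_nonempty (f : varLp p μ) : (luxSet p μ (f : X →ₘ[μ] ℝ)).Nonempty :=
  luxSet_nonempty (f : X →ₘ[μ] ℝ).aemeasurable f.2

theorem varLp_norm_smul_le {c : ℝ} (hc : c ≠ 0) (f : varLp p μ) : ‖c • f‖ ≤ |c| * ‖f‖ := by
  have h : ((c • f : varLp p μ) : X →ₘ[μ] ℝ) =ᵐ[μ] fun x => c * (f : X →ₘ[μ] ℝ) x :=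
    (AEEqFun.coeFn_smul c (f : X →ₘ[μ] ℝ)).mono fun x hx => by
      simpa using hx
  rw [varLp_norm_def, varLp_norm_def, luxNorm, luxSet_congr h]
  exact luxNorm_smul_le (varLp_nonempty f) hc

theorem varLp_norm_zero : ‖(0 : varLp p μ)‖ = 0 := by
  have h : ‖(2 : ℝ)⁻¹ • (0 : varLp p μ)‖ ≤ |(2 : ℝ)⁻¹| * ‖(0 : varLp p μ)‖ :=
    varLp_norm_smul_le (by norm_num) 0
  rw [smul_zero, abs_of_pos (by norm_num)] at h
  have h0 : 0 ≤ ‖(0 : varLp p μ)‖ := luxNorm_nonneg _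
  linarith

variable (p μ)

theorem varLp_core : NormedSpace.Core ℝ (varLp p μ) where
  norm_nonneg f := luxNorm_nonneg _
  norm_smul c f := by
    by_cases hc : c = 0
    · rw [hc, zero_smul, varLp_norm_zero, norm_zero, zero_mul]
    · refine le_antisymm (varLp_norm_smul_le hc f) ?_
      have h := varLp_norm_smul_le (inv_ne_zero hc) (c • f)
      rw [smul_smul, inv_mul_cancel₀ hc, one_smul, abs_inv] at h
      have hc' : 0 < |c| := abs_pos.2 hc
      rw [Real.norm_eq_abs]
      calc |c| * ‖f‖ ≤ |c| * (|c|⁻¹ * ‖c • f‖) := mul_le_mul_of_nonneg_left h hc'.le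
        _ = ‖c • f‖ := by rw [← mul_assoc, mul_inv_cancel₀ hc'.ne', one_mul]
  norm_triangle f g := by
    have h : ((f + g : varLp p μ) : X →ₘ[μ] ℝ) =ᵐ[μ]
        fun x => (f : X →ₘ[μ] ℝ) x + (g : X →ₘ[μ] ℝ) x :=
      (AEEqFun.coeFn_add (f : X →ₘ[μ] ℝ) g).mono fun x hx => by simpa using hx
    rw [varLp_norm_def, varLp_norm_def, varLp_norm_def, luxNorm, luxSet_congr h]
    exact luxNorm_add_le (f : X →ₘ[μ] ℝ).aemeasurable (g : X →ₘ[μ] ℝ).aemeasurable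
      (varLp_nonempty f) (varLp_nonempty g)
  norm_eq_zero_iff f := by
    refine ⟨fun h => ?_, fun h => by rw [h, varLp_norm_zero]⟩
    have h0 := ae_eq_zero_of_luxNorm (f : X →ₘ[μ] ℝ).aemeasurable (varLp_nonempty f) h
    refine Subtype.ext (AEEqFun.ext ?_)
    exact h0.trans AEEqFun.coeFn_zero.symm

noncomputable instance : NormedAddCommGroup (varLp p μ) :=
  NormedAddCommGroup.ofCore (varLp_core p μ)

noncomputable instance : NormedSpace ℝ (varLp p μ) :=
  NormedSpace.ofCore (varLp_core p μ)

/-- The map `φ` sends `L^{p(·)}` into `L^{p_φ(·)}` by composition, i.e. the domain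
`{f ∈ L^{p(·)} : f ∘ φ ∈ L^{p_φ(·)}}` of `T_φ` is all of `L^{p(·)}`. -/
def CompMaps {φ : X → X} (hφ : Measure.QuasiMeasurePreserving φ μ μ) : Prop :=
  ∀ f ∈ varLp p μ, f.compQuasiMeasurePreserving φ hφ ∈ varLp (p.comp hφ.measurable) μ

/-- The composition operator `T_φ : L^{p(·)} → L^{p_φ(·)}`, `f ↦ f ∘ φ`. -/
noncomputable def compOp {φ : X → X} (hφ : Measure.QuasiMeasurePreserving φ μ μ)
    (h : CompMaps p μ hφ) : varLp p μ →ₗ[ℝ] varLp (p.comp hφ.measurable) μ where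
  toFun f := ⟨(f : X →ₘ[μ] ℝ).compQuasiMeasurePreserving φ hφ, h f f.2⟩
  map_add' := by
    rintro ⟨f, hf⟩ ⟨g, hg⟩
    refine Subtype.ext ?_
    change (f + g).compQuasiMeasurePreserving φ hφ =
      f.compQuasiMeasurePreserving φ hφ + g.compQuasiMeasurePreserving φ hφ
    induction f using AEEqFun.induction_on
    induction g using AEEqFun.induction_on
    rfl
  map_smul' := by
    rintro c ⟨f, hf⟩
    refine Subtype.ext ?_
    change (c • f).compQuasiMeasurePreserving φ hφ = c • f.compQuasiMeasurePreserving φ hφ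
    induction f using AEEqFun.induction_on
    rfl

/-- Multiplication by (the class of) `v` maps `L^{p(·)}` into itself. -/
def MulMaps (v : X →ₘ[μ] ℝ) : Prop := ∀ f ∈ varLp p μ, v * f ∈ varLp p μ

/-- The multiplication operator `M_v : L^{p(·)} → L^{p(·)}`, `f ↦ v f`. -/
noncomputable def mulOp (v : X →ₘ[μ] ℝ) (h : MulMaps p μ v) : varLp p μ →ₗ[ℝ] varLp p μ where
  toFun f := ⟨v * (f : X →ₘ[μ] ℝ), h f f.2⟩
  map_add' := by
    rintro ⟨f, hf⟩ ⟨g, hg⟩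
    refine Subtype.ext ?_
    change v * (f + g) = v * f + v * g
    refine AEEqFun.ext ?_
    filter_upwards [AEEqFun.coeFn_mul v (f + g), AEEqFun.coeFn_add f g,
      AEEqFun.coeFn_add (v * f) (v * g), AEEqFun.coeFn_mul v f, AEEqFun.coeFn_mul v g]
      with x h1 h2 h3 h4 h5
    simp only [h1, h3, Pi.mul_apply, Pi.add_apply, h2, h4, h5, mul_add]
  map_smul' := by
    rintro c ⟨f, hf⟩
    refine Subtype.ext ?_
    change v * (c • f) = c • (v * f)
    refine AEEqFun.ext ?_
    filter_upwards [AEEqFun.coeFn_mul v (c • f), AEEqFun.coeFn_smul c f,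
      AEEqFun.coeFn_smul c (v * f), AEEqFun.coeFn_mul v f] with x h1 h2 h3 h4
    simp only [h1, h3, Pi.mul_apply, Pi.smul_apply, h2, h4, smul_eq_mul]
    ring

/-- The Radon-Nikodym derivative `u_φ` of `μ ∘ φ⁻¹` with respect to `μ`. -/
noncomputable def rnComp (φ : X → X) : X → ℝ≥0∞ := (μ.map φ).rnDeriv μ

/-- The symbol `v_φ = u_φ ^ (1 / p(·))`, as a class of measurable functions. -/
noncomputable def symbolComp (φ : X → X) : X →ₘ[μ] ℝ :=
  AEEqFun.mk (fun x => (rnComp μ φ x).toReal ^ (1 / p x))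
    (((Measure.measurable_rnDeriv (μ.map φ) μ).ennreal_toReal.pow
      (p.measurable'.const_div 1)).aestronglyMeasurable)

end Space

/-- `S` is relatively weakly compact: its closure in the weak topology is compact in the weak
topology. -/
def IsRelWeaklyCompact {E : Type*} [NormedAddCommGroup E] [NormedSpace ℝ E] (S : Set E) : Prop :=
  IsCompact (closure (toWeakSpace ℝ E '' S))

/-- A linear operator is weakly compact if it sends the closed unit ball to a relatively weakly
compact set. -/
def IsWeaklyCompactOp {E F : Type*} [NormedAddCommGroup E] [NormedSpace ℝ E]
    [NormedAddCommGroup F] [NormedSpace ℝ F] (T : E →ₗ[ℝ] F) : Prop :=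
  IsRelWeaklyCompact (T '' Metric.closedBall 0 1)

end VariableLebesgue

namespace VariableLebesgue

open Filter Topology

/-! ### Weak compactness and operators dominated in norm -/

section Weak

variable {E F G : Type*} [NormedAddCommGroup E] [NormedSpace ℝ E]
  [NormedAddCommGroup F] [NormedSpace ℝ F] [NormedAddCommGroup G] [NormedSpace ℝ G]

/-! Everything reduces to norm estimates. Over a finite measure `varLp` embeds continuously in `L¹`;
with Fatou's lemma this makes it complete and gives norm-convergent sequences a.e. convergent
subsequences. The closed graph theorem then shows that `compOp` is bounded (`continuous_compOp`).
Bounded operators are weakly continuous, which gives (w1).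

For (w2), the change of variables `∫ F ∘ φ = ∫ u_φ F` shows that `f ∘ φ` and `v_φ f` have the same
modular at every scale, hence the same norm (`norm_mulOp_symbolComp`). An operator dominated in norm
by a weakly compact one is weakly compact, since it factors through the closure of the range of the
latter (`IsWeaklyCompactOp.of_norm_le`). Applied in both directions this is the equivalence.

For (w3), the lower bound on `u_φ` makes `compOp` bounded below, so weak compactness of `compOp`
would pass to the identity. It remains to see that the unit ball is not relatively weakly compact
when the exponent exceeds 1 a.e. but has essential infimum 1. Cut the space into the levels of `N =
⌊1 / (p - 1)⌋` and normalize a function on each level. A weight `w` in the dual space has integral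
1/2 against every such function, while the functions move off to levels of ever larger index. A weak
cluster point `a` would satisfy `∫ a w = 1/2` and `∫ a w = 0` over each `{N ≤ j}`, which is absurd.
-/

theorem toWeakSpace_image_image (T : E →L[ℝ] F) (S : Set E) :
    toWeakSpace ℝ F '' (T '' S) = WeakSpace.map T '' (toWeakSpace ℝ E '' S) := by
  rw [Set.image_image, Set.image_image]
  rfl

theorem IsRelWeaklyCompact.image {S : Set E} (hS : IsRelWeaklyCompact S) (T : E →L[ℝ] F) :
    IsRelWeaklyCompact (T '' S) := by
  have hc : IsCompact (WeakSpace.map T '' closure (toWeakSpace ℝ E '' S)) :=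
    IsCompact.image hS (WeakSpace.map T).continuous
  unfold IsRelWeaklyCompact
  rw [toWeakSpace_image_image]
  exact hc.of_isClosed_subset isClosed_closure
    (closure_minimal (Set.image_mono subset_closure) hc.isClosed)

/-- The weak topology of a subspace is induced by the weak topology of the whole space. -/
theorem isInducing_weakSpace_map_subtypeL (Y : Submodule ℝ E) :
    IsInducing (WeakSpace.map Y.subtypeL) := by
  refine ⟨le_antisymm (WeakSpace.map Y.subtypeL).continuous.le_induced ?_⟩
  refine continuous_iff_le_induced.1 ?_
  refine @continuous_pi _ _ _ (.induced (WeakSpace.map Y.subtypeL) inferInstance) _ _ fun g => ?_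
  -- Hahn–Banach: each functional on `Y` is the restriction of one on `E`, so the induced topology
  -- already makes it continuous.
  obtain ⟨g', hg', -⟩ := exists_extension_norm_eq Y g
  have h : Continuous fun x : WeakSpace ℝ E => g' ((toWeakSpace ℝ E).symm x) :=
    WeakBilin.eval_continuous _ g'
  have h2 := @Continuous.comp _ _ _ (.induced (WeakSpace.map Y.subtypeL) inferInstance) _ _
    (WeakSpace.map Y.subtypeL) _ h continuous_induced_dom
  convert h2 using 1
  funext x
  exact (hg' ((toWeakSpace ℝ Y).symm x)).symm

theorem isClosedEmbedding_weakSpace_map_subtypeL {Y : Submodule ℝ E} (hY : IsClosed (Y : Set E)) :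
    IsClosedEmbedding (WeakSpace.map Y.subtypeL) := by
  refine ⟨⟨isInducing_weakSpace_map_subtypeL Y, fun a b h => Subtype.ext h⟩, ?_⟩
  have h : Set.range (WeakSpace.map Y.subtypeL) = toWeakSpace ℝ E '' (Y : Set E) := by
    ext x
    exact ⟨fun ⟨y, hy⟩ => ⟨_, ((toWeakSpace ℝ Y).symm y).2, hy⟩,
      fun ⟨y, hy, hxy⟩ => ⟨toWeakSpace ℝ Y ⟨y, hy⟩, hxy⟩⟩
  -- Mazur: a norm-closed convex set is weakly closed.
  rw [h, ← hY.closure_eq, Convex.toWeakSpace_closure ℝ Y.convex]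
  exact isClosed_closure

theorem IsRelWeaklyCompact.of_image_subtypeL {Y : Submodule ℝ E} (hY : IsClosed (Y : Set E))
    {S : Set Y} (hS : IsRelWeaklyCompact (Y.subtypeL '' S)) : IsRelWeaklyCompact S := by
  have he := isClosedEmbedding_weakSpace_map_subtypeL hY
  unfold IsRelWeaklyCompact at *
  rw [toWeakSpace_image_image, he.isClosedMap.closure_image_eq_of_continuous he.continuous] at hS
  exact he.isInducing.isCompact_iff.2 hS

/-- Weak compactness passes to operators that are dominated in norm. -/
theorem IsWeaklyCompactOp.of_norm_le [CompleteSpace G] {T : E →ₗ[ℝ] F} {M : E →ₗ[ℝ] G} {C : ℝ}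
    (hT : IsWeaklyCompactOp T) (h : ∀ x, ‖M x‖ ≤ C * ‖T x‖) : IsWeaklyCompactOp M := by
  -- The bound makes `T x ↦ M x` well defined and bounded on the range of `T`. As `G` is complete it
  -- extends to `Y`, and `M` is this extension composed with `T`. Passing to the closed subspace `Y`
  -- does not lose relative weak compactness.
  set Y : Submodule ℝ F := (LinearMap.range T).topologicalClosure with hYdef
  have hY : IsClosed (Y : Set F) := Submodule.isClosed_topologicalClosure _
  have hmem : ∀ x, T x ∈ Y := fun x => Submodule.le_topologicalClosure _ ⟨x, rfl⟩
  set e : E →ₗ[ℝ] Y := T.codRestrict Y hmem with he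
  have hdense : DenseRange e := by
    intro y
    rw [closure_subtype]
    have : ((↑) : Y → F) '' Set.range e = (LinearMap.range T : Set F) := by
      ext z
      simp [e]
    rw [this]
    exact y.2
  have hK : ∀ x, M.extendOfNorm e (e x) = M x :=
    LinearMap.extendOfNorm_eq hdense ⟨C, h⟩
  have hS : IsRelWeaklyCompact (e '' Metric.closedBall 0 1) := by
    refine IsRelWeaklyCompact.of_image_subtypeL hY ?_
    rw [Set.image_image]
    exact hT
  have := hS.image (M.extendOfNorm e)
  rw [Set.image_image] at this
  simp only [hK] at this
  exact this

end Weak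

/-! ### Inclusion in `L¹` and completeness of the variable Lebesgue space -/

section Banach

variable {X : Type*} [MeasurableSpace X] {p : VarExponent X} {μ : Measure X}

/-- Fatou's lemma, as `t ↦ t ^ p x` is continuous for each `x`. -/
theorem modular_le_of_tendsto_ae {f : ℕ → X → ℝ} {g : X → ℝ} {C : ℝ≥0∞}
    (hf : ∀ n, AEMeasurable (f n) μ) (h : ∀ᵐ x ∂μ, Tendsto (fun n => f n x) atTop (𝓝 (g x)))
    (hC : ∀ᶠ n in atTop, modular p μ (f n) ≤ C) : modular p μ g ≤ C := by
  have hlim : modular p μ g = ∫⁻ x, liminf (fun n => ‖f n x‖ₑ ^ (p x)) atTop ∂μ := by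
    refine lintegral_congr_ae ?_
    filter_upwards [h] with x hx
    exact (((ENNReal.continuous_rpow_const (y := p x)).tendsto _).comp hx.enorm).liminf_eq.symm
  rw [hlim]
  refine (lintegral_liminf_le' fun n => (hf n).enorm.pow p.measurable'.aemeasurable).trans ?_
  exact liminf_le_of_frequently_le' hC.frequently

theorem norm_le_of_modular_le_one (f : varLp p μ) {c : ℝ} (hc : 0 < c)
    (h : modular p μ (fun x => (f : X →ₘ[μ] ℝ) x / c) ≤ 1) : ‖f‖ ≤ c :=
  csInf_le (luxSet_bddBelow _) ⟨hc, h⟩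

theorem modular_div_le_one_of_norm_lt (f : varLp p μ) {c : ℝ} (hc : ‖f‖ < c) :
    modular p μ (fun x => (f : X →ₘ[μ] ℝ) x / c) ≤ 1 :=
  (luxSet_of_lt (f : X →ₘ[μ] ℝ).aemeasurable (varLp_nonempty f) hc).2

theorem coeFn_varLp_sub (f g : varLp p μ) :
    ((f - g : varLp p μ) : X →ₘ[μ] ℝ) =ᵐ[μ]
      fun x => (f : X →ₘ[μ] ℝ) x - (g : X →ₘ[μ] ℝ) x :=
  AEEqFun.coeFn_sub (f : X →ₘ[μ] ℝ) g

/-- A bound for `∫ |f w|` on the unit ball of the modular scales with the Luxemburg norm. -/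
theorem lintegral_enorm_mul_le {w : X → ℝ} {K : ℝ≥0∞}
    (hK : ∀ f : X → ℝ, AEMeasurable f μ → modular p μ f ≤ 1 → ∫⁻ x, ‖f x * w x‖ₑ ∂μ ≤ K)
    (f : varLp p μ) :
    ∫⁻ x, ‖(f : X →ₘ[μ] ℝ) x * w x‖ₑ ∂μ ≤ ENNReal.ofReal ‖f‖ * K := by
  have hbound : ∀ c : ℝ, ‖f‖ < c →
      ∫⁻ x, ‖(f : X →ₘ[μ] ℝ) x * w x‖ₑ ∂μ ≤ ENNReal.ofReal c * K := by
    intro c hc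
    have hc0 : 0 < c := (norm_nonneg f).trans_lt hc
    have h := hK _ ((f : X →ₘ[μ] ℝ).aemeasurable.div_const c) (modular_div_le_one_of_norm_lt f hc)
    refine le_trans (le_of_eq ?_) (mul_le_mul' le_rfl h)
    rw [← lintegral_const_mul' _ _ ENNReal.ofReal_ne_top]
    refine lintegral_congr fun x => ?_
    rw [← Real.enorm_of_nonneg hc0.le, ← enorm_mul]
    congr 1
    field_simp
  -- The bound at `‖f‖` itself comes from letting `c` decrease to `‖f‖`. Multiplication by `K = ∞`
  -- is not continuous at 0, so that case is separate; there, `‖f‖ = 0` forces `f = 0` a.e.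
  by_cases hK0 : K = ∞
  · by_cases hf : ‖f‖ = 0
    · have h0 := ae_eq_zero_of_luxNorm (f : X →ₘ[μ] ℝ).aemeasurable (varLp_nonempty f) hf
      have : ∫⁻ x, ‖(f : X →ₘ[μ] ℝ) x * w x‖ₑ ∂μ = 0 := by
        rw [← lintegral_zero (μ := μ)]
        refine lintegral_congr_ae ?_
        filter_upwards [h0] with x hx
        simp [hx]
      rw [this]
      exact zero_le
    · have : 0 < ‖f‖ := lt_of_le_of_ne (norm_nonneg f) (Ne.symm hf)
      rw [hK0, ENNReal.mul_top (by simpa using this)]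
      exact le_top
  · have ht : Tendsto (fun c : ℝ => ENNReal.ofReal c * K) (𝓝[>] ‖f‖)
        (𝓝 (ENNReal.ofReal ‖f‖ * K)) :=
      ENNReal.Tendsto.mul_const
        ((ENNReal.continuous_ofReal.tendsto _).mono_left nhdsWithin_le_nhds) (Or.inr hK0)
    exact ge_of_tendsto ht (eventually_nhdsWithin_of_forall hbound)

theorem lintegral_enorm_le [IsFiniteMeasure μ] (f : varLp p μ) :
    ∫⁻ x, ‖(f : X →ₘ[μ] ℝ) x‖ₑ ∂μ ≤ ENNReal.ofReal ‖f‖ * (μ Set.univ + 1) := by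
  have h := lintegral_enorm_mul_le (p := p) (μ := μ) (w := fun _ => 1) (K := μ Set.univ + 1)
    (fun f hf h1 => ?_) f
  · simpa using h
  · calc ∫⁻ x, ‖f x * 1‖ₑ ∂μ ≤ ∫⁻ x, (1 + ‖f x‖ₑ ^ (p x)) ∂μ := by
          -- Pointwise `t ≤ 1 + t ^ p`, because `p ≥ 1`.
          refine lintegral_mono fun x => ?_
          rw [mul_one]
          rcases le_total ‖f x‖ₑ 1 with h | h
          · exact h.trans le_self_add
          · exact (ENNReal.rpow_one _).symm.le.trans
              ((ENNReal.rpow_le_rpow_of_exponent_le h (p.one_le' x)).trans le_add_self)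
      _ = μ Set.univ + modular p μ f := by
          rw [lintegral_add_left measurable_const, lintegral_one]
          rfl
      _ ≤ _ := add_le_add le_rfl h1

theorem memLp_one_varLp [IsFiniteMeasure μ] (f : varLp p μ) :
    MemLp (f : X →ₘ[μ] ℝ) 1 μ := by
  refine ⟨(f : X →ₘ[μ] ℝ).aestronglyMeasurable, ?_⟩
  rw [eLpNorm_one_eq_lintegral_enorm]
  exact (lintegral_enorm_le f).trans_lt
    (ENNReal.mul_lt_top ENNReal.ofReal_lt_top (by finiteness))

variable (p μ) in
/-- The inclusion of `L^{p(·)}` in `L¹` over a finite measure space. -/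
noncomputable def toLpOne [IsFiniteMeasure μ] : varLp p μ →L[ℝ] Lp ℝ 1 μ :=
  LinearMap.mkContinuous
    { toFun := fun f => ⟨f, by
        rw [Lp.mem_Lp_iff_memLp]
        exact memLp_one_varLp f⟩
      map_add' := fun _ _ => rfl
      map_smul' := fun _ _ => rfl }
    (μ Set.univ + 1).toReal fun f => by
      change ENNReal.toReal (eLpNorm (f : X →ₘ[μ] ℝ) 1 μ) ≤ _
      rw [eLpNorm_one_eq_lintegral_enorm, mul_comm]
      refine ENNReal.toReal_le_of_le_ofReal (by positivity) ?_
      rw [ENNReal.ofReal_mul (norm_nonneg f), ENNReal.ofReal_toReal (by finiteness)]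
      exact lintegral_enorm_le f

theorem coe_toLpOne [IsFiniteMeasure μ] (f : varLp p μ) :
    ((toLpOne p μ f : Lp ℝ 1 μ) : X →ₘ[μ] ℝ) = f := rfl

theorem exists_seq_tendsto_ae_of_tendsto_toLpOne [IsFiniteMeasure μ] {u : ℕ → varLp p μ}
    {g : Lp ℝ 1 μ} (h : Tendsto (fun n => toLpOne p μ (u n)) atTop (𝓝 g)) :
    ∃ ns : ℕ → ℕ, StrictMono ns ∧
      ∀ᵐ x ∂μ, Tendsto (fun k => (u (ns k) : X →ₘ[μ] ℝ) x) atTop (𝓝 (g x)) :=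
  (tendstoInMeasure_of_tendsto_Lp h).exists_seq_tendsto_ae

theorem exists_seq_tendsto_ae_varLp [IsFiniteMeasure μ] {u : ℕ → varLp p μ} {f : varLp p μ}
    (h : Tendsto u atTop (𝓝 f)) :
    ∃ ns : ℕ → ℕ, StrictMono ns ∧
      ∀ᵐ x ∂μ, Tendsto (fun k => (u (ns k) : X →ₘ[μ] ℝ) x) atTop (𝓝 ((f : X →ₘ[μ] ℝ) x)) := by
  have h1 : Tendsto (fun n => toLpOne p μ (u n)) atTop (𝓝 (toLpOne p μ f)) :=
    ((toLpOne p μ).continuous.tendsto f).comp h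
  simpa only [coe_toLpOne] using exists_seq_tendsto_ae_of_tendsto_toLpOne h1

/-- A Cauchy sequence along which a subsequence converges almost everywhere is controlled by the
pointwise limit. -/
theorem exists_modular_sub_div_le_one_of_cauchySeq {u : ℕ → varLp p μ} (hu : CauchySeq u)
    {ns : ℕ → ℕ} (hns : StrictMono ns) {g : X →ₘ[μ] ℝ}
    (hae : ∀ᵐ x ∂μ, Tendsto (fun k => (u (ns k) : X →ₘ[μ] ℝ) x) atTop (𝓝 (g x)))
    {ε : ℝ} (hε : 0 < ε) :
    ∃ N, ∀ n ≥ N, modular p μ (fun x => (g - (u n : X →ₘ[μ] ℝ)) x / ε) ≤ 1 := by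
  obtain ⟨N, hN⟩ := Metric.cauchySeq_iff.1 hu ε hε
  refine ⟨N, fun n hn => ?_⟩
  -- Fatou in `k` with `n` fixed: `u (ns k) - u n` tends a.e. to `g - u n`, and its norm is below
  -- `ε` for large `k`.
  refine modular_le_of_tendsto_ae
    (f := fun k x => ((u (ns k) - u n : varLp p μ) : X →ₘ[μ] ℝ) x / ε)
    (fun k => ((u (ns k) - u n : varLp p μ) : X →ₘ[μ] ℝ).aemeasurable.div_const ε) ?_ ?_
  · have h1 := ae_all_iff.2 fun k => coeFn_varLp_sub (u (ns k)) (u n)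
    filter_upwards [hae, h1, AEEqFun.coeFn_sub g (u n : X →ₘ[μ] ℝ)] with x hx h1 h2
    rw [h2]
    simp only [h1, Pi.sub_apply]
    exact (hx.sub_const _).div_const _
  · filter_upwards [eventually_ge_atTop N] with k hk
    refine modular_div_le_one_of_norm_lt _ ?_
    rw [← dist_eq_norm]
    exact hN _ (hk.trans (hns.id_le k)) _ hn

theorem exists_tendsto_of_cauchySeq_varLp {u : ℕ → varLp p μ} (hu : CauchySeq u)
    {ns : ℕ → ℕ} (hns : StrictMono ns) {g : X →ₘ[μ] ℝ}
    (hae : ∀ᵐ x ∂μ, Tendsto (fun k => (u (ns k) : X →ₘ[μ] ℝ) x) atTop (𝓝 (g x))) :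
    ∃ f, Tendsto u atTop (𝓝 f) := by
  have hmem : g ∈ varLp p μ := by
    obtain ⟨N, hN⟩ := exists_modular_sub_div_le_one_of_cauchySeq hu hns hae one_pos
    have h : g - u N ∈ varLp p μ :=
      ⟨1, one_pos, (hN N le_rfl).trans_lt ENNReal.one_lt_top⟩
    rw [← sub_add_cancel g (u N : X →ₘ[μ] ℝ)]
    exact (varLp p μ).add_mem h (u N).2
  refine ⟨⟨g, hmem⟩, Metric.tendsto_atTop.2 fun ε hε => ?_⟩
  obtain ⟨N, hN⟩ := exists_modular_sub_div_le_one_of_cauchySeq hu hns hae (half_pos hε)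
  refine ⟨N, fun n hn => ?_⟩
  rw [dist_comm, dist_eq_norm]
  refine lt_of_le_of_lt ?_ (half_lt_self hε)
  refine norm_le_of_modular_le_one _ (half_pos hε) ?_
  rw [Submodule.coe_sub]
  exact hN n hn

instance [IsFiniteMeasure μ] : CompleteSpace (varLp p μ) := by
  refine Metric.complete_of_cauchySeq_tendsto fun u hu => ?_
  have hu1 : CauchySeq fun n => toLpOne p μ (u n) :=
    (toLpOne p μ).uniformContinuous.comp_cauchySeq hu
  obtain ⟨g, hg⟩ := cauchySeq_tendsto_of_complete hu1
  obtain ⟨ns, hns, hae⟩ := exists_seq_tendsto_ae_of_tendsto_toLpOne hg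
  exact exists_tendsto_of_cauchySeq_varLp hu hns hae

end Banach

/-! ### The composition operator and its multiplication symbol -/

section Composition

variable {X : Type*} [MeasurableSpace X] {p : VarExponent X} {μ : Measure X} {φ : X → X}
  {hφ : Measure.QuasiMeasurePreserving φ μ μ}

theorem coeFn_compOp (h : CompMaps p μ hφ) (f : varLp p μ) :
    (compOp p μ hφ h f : X →ₘ[μ] ℝ) =ᵐ[μ] fun x => (f : X →ₘ[μ] ℝ) (φ x) :=
  AEEqFun.coeFn_compQuasiMeasurePreserving (f : X →ₘ[μ] ℝ) hφ

variable [IsFiniteMeasure μ]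

/-- Closed graph theorem. Along a common subsequence `u → f` and `u ∘ φ → g` a.e.; since preimages
of null sets under `φ` are null, also `u ∘ φ → f ∘ φ` a.e., so `g = f ∘ φ`. -/
theorem continuous_compOp (h : CompMaps p μ hφ) :
    Continuous (compOp p μ hφ h) := by
  refine LinearMap.continuous_of_seq_closed_graph _ fun u f g hu hTu => ?_
  obtain ⟨ns, hns, hf⟩ := exists_seq_tendsto_ae_varLp hu
  obtain ⟨ms, hms, hg⟩ := exists_seq_tendsto_ae_varLp (hTu.comp hns.tendsto_atTop)
  refine Subtype.ext (AEEqFun.ext ?_)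
  have hT := ae_all_iff.2 fun k => coeFn_compOp h (u (ns (ms k)))
  filter_upwards [hφ.ae hf, hg, hT, coeFn_compOp h f] with x h1 h2 h3 h4
  rw [h4]
  refine tendsto_nhds_unique h2 ?_
  simp only [Function.comp_apply, h3]
  exact h1.comp hms.tendsto_atTop

theorem lintegral_comp_eq_lintegral_rnComp_mul (hφ : Measure.QuasiMeasurePreserving φ μ μ)
    {F : X → ℝ≥0∞} (hF : AEMeasurable F μ) :
    ∫⁻ x, F (φ x) ∂μ = ∫⁻ x, rnComp μ φ x * F x ∂μ := by
  unfold rnComp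
  rw [lintegral_rnDeriv_mul hφ.absolutelyContinuous hF,
    lintegral_map' (hF.mono_ac hφ.absolutelyContinuous) hφ.measurable.aemeasurable]

theorem modular_comp_eq_lintegral (hφ : Measure.QuasiMeasurePreserving φ μ μ) (f : X →ₘ[μ] ℝ)
    (η : ℝ) :
    modular (p.comp hφ.measurable) μ (fun x => f.compQuasiMeasurePreserving φ hφ x / η) =
      ∫⁻ x, rnComp μ φ x * ‖f x / η‖ₑ ^ (p x) ∂μ := by
  rw [← lintegral_comp_eq_lintegral_rnComp_mul hφ
    ((f.aemeasurable.div_const η).enorm.pow p.measurable'.aemeasurable)]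
  refine lintegral_congr_ae ?_
  filter_upwards [AEEqFun.coeFn_compQuasiMeasurePreserving f hφ] with x hx
  rw [hx]
  rfl

/-- The power `p x` undoes the root `1 / p x` in the symbol. The derivative is finite a.e., so
`toReal` loses nothing. -/
theorem modular_symbolComp_mul_eq_lintegral (f : X →ₘ[μ] ℝ) (η : ℝ) :
    modular p μ (fun x => (symbolComp p μ φ * f) x / η) =
      ∫⁻ x, rnComp μ φ x * ‖f x / η‖ₑ ^ (p x) ∂μ := by
  refine lintegral_congr_ae ?_
  filter_upwards [AEEqFun.coeFn_mul (symbolComp p μ φ) f,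
    AEEqFun.coeFn_mk (fun x => (rnComp μ φ x).toReal ^ (1 / p x))
    (((Measure.measurable_rnDeriv (μ.map φ) μ).ennreal_toReal.pow
      (p.measurable'.const_div 1)).aestronglyMeasurable),
    Measure.rnDeriv_lt_top (μ.map φ) μ] with x h1 h2 h3
  have hp : 0 < p x := one_pos.trans_le (p.one_le' x)
  have h4 : symbolComp p μ φ x = (rnComp μ φ x).toReal ^ (1 / p x) := h2
  rw [h1, Pi.mul_apply, h4, mul_div_assoc, enorm_mul, ENNReal.mul_rpow_of_nonneg _ _ hp.le]
  congr 1
  rw [Real.enorm_of_nonneg (by positivity),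
    ← ENNReal.ofReal_rpow_of_nonneg ENNReal.toReal_nonneg (by positivity),
    ← ENNReal.rpow_mul, one_div_mul_cancel hp.ne', ENNReal.rpow_one]
  exact ENNReal.ofReal_toReal h3.ne

theorem modular_symbolComp_mul_eq_modular_comp (f : X →ₘ[μ] ℝ) (η : ℝ) :
    modular p μ (fun x => (symbolComp p μ φ * f) x / η) =
      modular (p.comp hφ.measurable) μ (fun x => f.compQuasiMeasurePreserving φ hφ x / η) := by
  rw [modular_symbolComp_mul_eq_lintegral, modular_comp_eq_lintegral]

theorem CompMaps.mulMaps (h : CompMaps p μ hφ) : MulMaps p μ (symbolComp p μ φ) := by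
  intro f hf
  obtain ⟨η, hη, hfin⟩ := h f hf
  exact ⟨η, hη, by rwa [modular_symbolComp_mul_eq_modular_comp (hφ := hφ)]⟩

theorem norm_mulOp_symbolComp (h : CompMaps p μ hφ) (hM : MulMaps p μ (symbolComp p μ φ))
    (f : varLp p μ) : ‖mulOp p μ (symbolComp p μ φ) hM f‖ = ‖compOp p μ hφ h f‖ := by
  have hset : luxSet p μ (symbolComp p μ φ * (f : X →ₘ[μ] ℝ) : X →ₘ[μ] ℝ) =
      luxSet (p.comp hφ.measurable) μ ((f : X →ₘ[μ] ℝ).compQuasiMeasurePreserving φ hφ) := by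
    ext η
    unfold luxSet
    rw [Set.mem_ofPred_eq, Set.mem_ofPred_eq, modular_symbolComp_mul_eq_modular_comp (hφ := hφ)]
  exact congrArg sInf hset

/-- A lower bound for `u_φ` makes the composition operator bounded below. -/
theorem norm_le_mul_norm_compOp (h : CompMaps p μ hφ) {c : ℝ} (hc : 0 < c) (hc1 : c < 1)
    (hu : ∀ᵐ x ∂μ, ENNReal.ofReal c ≤ rnComp μ φ x) (f : varLp p μ) :
    ‖f‖ ≤ c⁻¹ * ‖compOp p μ hφ h f‖ := by
  rw [← div_eq_inv_mul, le_div_iff₀ hc]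
  refine le_of_forall_gt_imp_ge_of_dense fun d hd => ?_
  rw [← le_div_iff₀ hc]
  have hd0 : 0 < d := (norm_nonneg _).trans_lt hd
  have h1 : ∫⁻ x, rnComp μ φ x * ‖(f : X →ₘ[μ] ℝ) x / d‖ₑ ^ (p x) ∂μ ≤ 1 := by
    rw [← modular_comp_eq_lintegral hφ]
    exact modular_div_le_one_of_norm_lt _ hd
  refine norm_le_of_modular_le_one f (by positivity) ?_
  -- Since `c < 1`, enlarging the scale from `d` to `d / c` gains a factor `c` in the modular, and
  -- `c ≤ u_φ` absorbs it.
  have h2 := modular_div_le p (f : X →ₘ[μ] ℝ).aemeasurable hd0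
    (show d < d / c by rwa [lt_div_iff₀ hc, mul_lt_iff_lt_one_right hd0])
  rw [div_div_cancel₀ hd0.ne'] at h2
  refine h2.trans (le_trans ?_ h1)
  unfold modular
  rw [← lintegral_const_mul' _ _ ENNReal.ofReal_ne_top]
  refine lintegral_mono_ae ?_
  filter_upwards [hu] with x hx
  exact mul_le_mul' hx le_rfl

end Composition

/-! ### The unit ball is not weakly compact when the exponent approaches 1 -/

section Nonreflexive

variable {X : Type*} [MeasurableSpace X] {p : VarExponent X} {μ : Measure X}

theorem integrable_mul_of_lintegral_le {w : X → ℝ} (hw : AEStronglyMeasurable w μ) {K : ℝ≥0∞}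
    (hK0 : K ≠ ∞)
    (hK : ∀ f : X → ℝ, AEMeasurable f μ → modular p μ f ≤ 1 → ∫⁻ x, ‖f x * w x‖ₑ ∂μ ≤ K)
    (f : varLp p μ) : Integrable (fun x => (f : X →ₘ[μ] ℝ) x * w x) μ :=
  ⟨(f : X →ₘ[μ] ℝ).aestronglyMeasurable.mul hw, (lintegral_enorm_mul_le hK f).trans_lt
    (ENNReal.mul_lt_top ENNReal.ofReal_lt_top hK0.lt_top)⟩

/-- A weight that is integrable against the unit ball of the modular gives continuous functionals
on `L^{p(·)}`. -/
theorem exists_clm_eq_setIntegral_mul {w : X → ℝ} (hw : AEStronglyMeasurable w μ) {K : ℝ≥0∞}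
    (hK0 : K ≠ ∞)
    (hK : ∀ f : X → ℝ, AEMeasurable f μ → modular p μ f ≤ 1 → ∫⁻ x, ‖f x * w x‖ₑ ∂μ ≤ K)
    (s : Set X) :
    ∃ g : varLp p μ →L[ℝ] ℝ, ∀ f, g f = ∫ x in s, (f : X →ₘ[μ] ℝ) x * w x ∂μ := by
  have hint := integrable_mul_of_lintegral_le hw hK0 hK
  refine ⟨LinearMap.mkContinuous
    { toFun := fun f => ∫ x in s, (f : X →ₘ[μ] ℝ) x * w x ∂μ
      map_add' := fun f g => ?_
      map_smul' := fun c f => ?_ } K.toReal fun f => ?_, fun f => rfl⟩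
  · rw [← integral_add (hint f).integrableOn (hint g).integrableOn]
    refine integral_congr_ae (ae_restrict_of_ae ?_)
    filter_upwards [AEEqFun.coeFn_add (f : X →ₘ[μ] ℝ) g] with x hx
    rw [Submodule.coe_add, hx, Pi.add_apply, add_mul]
  · rw [RingHom.id_apply, smul_eq_mul, ← integral_const_mul]
    refine integral_congr_ae (ae_restrict_of_ae ?_)
    filter_upwards [AEEqFun.coeFn_smul c (f : X →ₘ[μ] ℝ)] with x hx
    rw [Submodule.coe_smul, hx, Pi.smul_apply, smul_eq_mul, mul_assoc]
  · change ‖∫ x in s, (f : X →ₘ[μ] ℝ) x * w x ∂μ‖ ≤ _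
    rw [← ENNReal.ofReal_le_ofReal_iff (by positivity), ofReal_norm]
    refine (enorm_integral_le_lintegral_enorm _).trans
      ((setLIntegral_le_lintegral _ _).trans ((lintegral_enorm_mul_le hK f).trans (le_of_eq ?_)))
    rw [ENNReal.ofReal_mul ENNReal.toReal_nonneg, ENNReal.ofReal_toReal hK0, mul_comm]

/-- Young's inequality with the conjugate exponent `s = q / (q - 1)`. Since `(1 / q - 1) * s = -1`,
the second factor to the power `s` is `2⁻¹ ^ s * m⁻¹`, and `hn` gives `s ≥ n`. The factor 1/2 is
what produces the geometric decay in `n`. -/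
theorem mul_rpow_le_rpow_add {t m q : ℝ} {n : ℕ} (ht : 0 ≤ t) (hm : 0 < m) (hq : 1 < q)
    (hn : n * (q - 1) ≤ 1) : t * (m ^ (1 / q - 1) / 2) ≤ t ^ q + 2⁻¹ ^ n * m⁻¹ := by
  have hq1 : 0 < q - 1 := sub_pos.2 hq
  have hconj := Real.HolderConjugate.conjExponent hq
  set s := q.conjExponent with hs
  have hseq : s = q / (q - 1) := hconj.conjugate_eq
  have hs1 : 1 < s := hconj.symm.lt
  have hns : (n : ℝ) ≤ s := by
    rw [hseq, le_div_iff₀ hq1]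
    exact hn.trans hq.le
  have hpow : (m ^ (1 / q - 1) / 2) ^ s = 2⁻¹ ^ s * m⁻¹ := by
    rw [div_eq_inv_mul, Real.mul_rpow (by norm_num) (by positivity), ← Real.rpow_mul hm.le,
      ← Real.rpow_neg_one m]
    congr 2
    rw [hseq]
    field_simp
    ring
  have h1 : t ^ q / q ≤ t ^ q := div_le_self (by positivity) hq.le
  have h2 : (m ^ (1 / q - 1) / 2) ^ s / s ≤ 2⁻¹ ^ n * m⁻¹ := by
    refine (div_le_self (by positivity) hs1.le).trans ?_
    rw [hpow, ← Real.rpow_natCast]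
    gcongr ?_ * _
    exact Real.rpow_le_rpow_of_exponent_ge (by norm_num) (by norm_num) hns
  exact (Real.young_inequality_of_nonneg ht (by positivity) hconj).trans (add_le_add h1 h2)

theorem MapClusterPt.eq_of_eventuallyEq {Y ι : Type*} [TopologicalSpace Y] [T1Space Y]
    {l : Filter ι} {u : ι → Y} {a c : Y} (h : MapClusterPt a l u) (hu : ∀ᶠ i in l, u i = c) :
    a = c := by
  by_contra hne
  obtain ⟨i, hi, hi'⟩ := ((mapClusterPt_iff_frequently.1 h _
    (isOpen_compl_singleton.mem_nhds hne)).and_eventually hu).exists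
  exact hi hi'

/-- The dual weight attached to a partition of the space into the level sets of `N`. -/
noncomputable def levelWeight (p : VarExponent X) (μ : Measure X) (N : X → ℕ) (x : X) : ℝ :=
  μ.real (N ⁻¹' {N x}) ^ (1 / p x - 1) / 2

/-- The normalized function on a level set of `N`. -/
noncomputable def levelFun (p : VarExponent X) (μ : Measure X) (N : X → ℕ) (k : ℕ) : X → ℝ :=
  (N ⁻¹' {k}).indicator fun x => μ.real (N ⁻¹' {k}) ^ (-(1 / p x))

variable {N : X → ℕ}

theorem measurable_levelWeight (hN : Measurable N) : Measurable (levelWeight p μ N) := by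
  have h : Measurable fun x => μ.real (N ⁻¹' {N x}) :=
    (measurable_of_countable fun k : ℕ => μ.real (N ⁻¹' {k})).comp hN
  exact (h.pow ((p.measurable'.const_div 1).sub_const 1)).div_const 2

theorem measurable_levelFun (hN : Measurable N) (k : ℕ) : Measurable (levelFun p μ N k) :=
  (measurable_const.pow (p.measurable'.const_div 1).neg).indicator (hN (measurableSet_singleton k))

theorem levelFun_mul_levelWeight {k : ℕ} (hk : 0 < μ.real (N ⁻¹' {k})) (x : X) :
    levelFun p μ N k x * levelWeight p μ N x =
      (N ⁻¹' {k}).indicator (fun _ => (μ.real (N ⁻¹' {k}))⁻¹ / 2) x := by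
  unfold levelFun levelWeight
  by_cases hx : x ∈ N ⁻¹' {k}
  · have hx' : N x = k := hx
    rw [Set.indicator_of_mem hx, Set.indicator_of_mem hx, hx', ← mul_div_assoc,
      ← Real.rpow_add hk, ← Real.rpow_neg_one]
    congr 2
    ring
  · rw [Set.indicator_of_notMem hx, Set.indicator_of_notMem hx, zero_mul]

/-- On level `k` the integrand is constant, and its integral is at most `2⁻¹ ^ k` because the
measure cancels; null levels contribute 0. -/
theorem lintegral_level_le_two (hN : Measurable N) :
    ∫⁻ x, 2⁻¹ ^ N x * (μ (N ⁻¹' {N x}))⁻¹ ∂μ ≤ 2 := by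
  rw [← lintegral_map (f := fun k : ℕ => (2⁻¹ : ℝ≥0∞) ^ k * (μ (N ⁻¹' {k}))⁻¹)
    (measurable_of_countable _) hN, lintegral_countable']
  refine le_of_le_of_eq ?_ ENNReal.tsum_geometric_two
  refine ENNReal.tsum_le_tsum fun k => ?_
  rw [Measure.map_apply hN (measurableSet_singleton k), mul_assoc]
  exact mul_le_of_le_one_right' (ENNReal.inv_mul_le_one _)

variable [IsFiniteMeasure μ]

theorem ae_measureReal_level_pos (hN : Measurable N) : ∀ᵐ x ∂μ, 0 < μ.real (N ⁻¹' {N x}) := by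
  have h : ∀ᵐ k ∂μ.map N, 0 < μ.real (N ⁻¹' {k}) := by
    rw [ae_iff_of_countable]
    intro k hk
    rw [Measure.map_apply hN (measurableSet_singleton k)] at hk
    exact measureReal_def μ _ ▸ ENNReal.toReal_pos hk (measure_ne_top _ _)
  exact ae_of_ae_map hN.aemeasurable h

/-- This places the weight in the dual space: Young's inequality is applied at each point with `m`
the measure of its level and `n = N x`. -/
theorem lintegral_mul_levelWeight_le (hN : Measurable N)
    (hp : ∀ᵐ x ∂μ, 1 < p x ∧ N x * (p x - 1) ≤ 1) (f : X → ℝ) (hf : AEMeasurable f μ)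
    (h1 : modular p μ f ≤ 1) : ∫⁻ x, ‖f x * levelWeight p μ N x‖ₑ ∂μ ≤ 3 := by
  calc ∫⁻ x, ‖f x * levelWeight p μ N x‖ₑ ∂μ
      ≤ ∫⁻ x, (‖f x‖ₑ ^ (p x) + 2⁻¹ ^ N x * (μ (N ⁻¹' {N x}))⁻¹) ∂μ := by
        refine lintegral_mono_ae ?_
        filter_upwards [hp, ae_measureReal_level_pos hN] with x hx hm
        have h := mul_rpow_le_rpow_add (norm_nonneg (f x)) hm hx.1 hx.2
        have hw : 0 ≤ levelWeight p μ N x := by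
          unfold levelWeight
          positivity
        have hpx : 0 ≤ p x := by linarith
        have e1 : ‖f x * levelWeight p μ N x‖ₑ = ENNReal.ofReal (‖f x‖ * levelWeight p μ N x) := by
          rw [← ofReal_norm, norm_mul, Real.norm_of_nonneg hw]
        rw [e1]
        refine (ENNReal.ofReal_le_ofReal h).trans (le_of_eq ?_)
        rw [ENNReal.ofReal_add (by positivity) (by positivity),
          ← ENNReal.ofReal_rpow_of_nonneg (norm_nonneg _) hpx, ofReal_norm,
          ENNReal.ofReal_mul (by positivity), ENNReal.ofReal_pow (by norm_num),
          ENNReal.ofReal_inv_of_pos hm, ENNReal.ofReal_inv_of_pos two_pos, ENNReal.ofReal_ofNat,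
          measureReal_def, ENNReal.ofReal_toReal (measure_ne_top _ _)]
    _ = modular p μ f + ∫⁻ x, 2⁻¹ ^ N x * (μ (N ⁻¹' {N x}))⁻¹ ∂μ :=
        lintegral_add_left' (hf.enorm.pow p.measurable'.aemeasurable) _
    _ ≤ 1 + 2 := add_le_add h1 (lintegral_level_le_two hN)
    _ = 3 := by norm_num

theorem modular_levelFun_le_one (hN : Measurable N) {k : ℕ} (hk : 0 < μ.real (N ⁻¹' {k})) :
    modular p μ (levelFun p μ N k) ≤ 1 := by
  have h : ∀ x, ‖levelFun p μ N k x‖ₑ ^ (p x) =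
      (N ⁻¹' {k}).indicator (fun _ => (μ (N ⁻¹' {k}))⁻¹) x := by
    intro x
    have hp : 0 < p x := one_pos.trans_le (p.one_le' x)
    unfold levelFun
    by_cases hx : x ∈ N ⁻¹' {k}
    · rw [Set.indicator_of_mem hx, Set.indicator_of_mem hx, Real.enorm_of_nonneg (by positivity),
        ENNReal.ofReal_rpow_of_nonneg (by positivity) hp.le, ← Real.rpow_mul hk.le, neg_mul,
        one_div_mul_cancel hp.ne', Real.rpow_neg_one, ENNReal.ofReal_inv_of_pos hk,
        measureReal_def, ENNReal.ofReal_toReal (measure_ne_top _ _)]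
    · rw [Set.indicator_of_notMem hx, Set.indicator_of_notMem hx, enorm_zero,
        ENNReal.zero_rpow_of_pos hp]
  unfold modular
  simp only [h]
  rw [lintegral_indicator (hN (measurableSet_singleton k)), lintegral_const,
    Measure.restrict_apply_univ]
  exact ENNReal.inv_mul_le_one _

/-- If the exponent is `> 1` but approaches `1` then the unit ball of `L^{p(·)}` is not weakly
compact. -/
theorem not_isRelWeaklyCompact_closedBall_of_level (hN : Measurable N)
    (hp : ∀ᵐ x ∂μ, 1 < p x ∧ N x * (p x - 1) ≤ 1) (hfreq : ∀ K, ∃ k ≥ K, μ (N ⁻¹' {k}) ≠ 0) :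
    ¬ IsRelWeaklyCompact (Metric.closedBall (0 : varLp p μ) 1) := by
  intro hcomp
  choose k hkK hk0 using hfreq
  have hkpos : ∀ K, 0 < μ.real (N ⁻¹' {k K}) := fun K =>
    measureReal_def μ _ ▸ ENNReal.toReal_pos (hk0 K) (measure_ne_top _ _)
  have hmeas : ∀ K, AEStronglyMeasurable (levelFun p μ N (k K)) μ := fun K =>
    (measurable_levelFun hN (k K)).aestronglyMeasurable
  have hmod : ∀ K, modular p μ (fun x =>
      AEEqFun.mk _ (hmeas K) x / 1)
        ≤ 1 := by
    intro K
    refine (modular_congr p ?_).trans_le (modular_levelFun_le_one (p := p) hN (hkpos K))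
    filter_upwards [AEEqFun.coeFn_mk _ (hmeas K)] with x hx
    rw [hx, div_one]
  let F : ℕ → varLp p μ := fun K =>
    ⟨AEEqFun.mk _ (hmeas K),
      1, one_pos, (hmod K).trans_lt ENNReal.one_lt_top⟩
  have hF : ∀ K, F K ∈ Metric.closedBall (0 : varLp p μ) 1 := fun K => by
    rw [mem_closedBall_zero_iff]
    exact norm_le_of_modular_le_one _ one_pos (hmod K)
  have hFw : ∀ K, (fun x => (F K : X →ₘ[μ] ℝ) x * levelWeight p μ N x) =ᵐ[μ]
      (N ⁻¹' {k K}).indicator (fun _ => (μ.real (N ⁻¹' {k K}))⁻¹ / 2) := by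
    intro K
    filter_upwards [AEEqFun.coeFn_mk _ (hmeas K)] with x hx
    rw [← levelFun_mul_levelWeight (p := p) (hkpos K) x, ← hx]
  obtain ⟨a, -, ha⟩ := IsCompact.exists_mapClusterPt hcomp (f := atTop)
    (u := fun K => toWeakSpace ℝ (varLp p μ) (F K))
    (tendsto_principal.2 (Eventually.of_forall fun K => subset_closure ⟨F K, hF K, rfl⟩))
  obtain ⟨a, rfl⟩ := (toWeakSpace ℝ (varLp p μ)).surjective a
  -- Continuous functionals are weakly continuous, so an eventually constant value along `F` is
  -- inherited by the cluster point.
  have hcl : ∀ (g : varLp p μ →L[ℝ] ℝ) (c : ℝ), (∀ᶠ K in atTop, g (F K) = c) → g a = c := by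
    intro g c hc
    have hg : Continuous fun x : WeakSpace ℝ (varLp p μ) => g ((toWeakSpace ℝ _).symm x) :=
      WeakBilin.eval_continuous _ g
    have hga := ha.continuousAt_comp hg.continuousAt
    exact MapClusterPt.eq_of_eventuallyEq hga hc
  have hw := (measurable_levelWeight (p := p) (μ := μ) hN).aestronglyMeasurable (μ := μ)
  have hK := lintegral_mul_levelWeight_le hN hp
  have hreal : ∀ s : Set X, (∀ᶠ K in atTop, ∀ x ∈ s, N x ≠ k K) →
      ∫ x in s, (a : X →ₘ[μ] ℝ) x * levelWeight p μ N x ∂μ = 0 := by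
    intro s hs
    obtain ⟨g, hg⟩ := exists_clm_eq_setIntegral_mul hw (by norm_num) hK s
    rw [← hg]
    refine hcl g 0 ?_
    filter_upwards [hs] with K hK
    have hempty : N ⁻¹' {k K} ∩ s = ∅ :=
      Set.eq_empty_of_forall_notMem fun x hx => hK x hx.2 hx.1
    rw [hg, integral_congr_ae (ae_restrict_of_ae (hFw K)),
      integral_indicator (hN (measurableSet_singleton _)),
      Measure.restrict_restrict (hN (measurableSet_singleton _)), hempty]
    simp
  have hhalf : ∫ x in Set.univ, (a : X →ₘ[μ] ℝ) x * levelWeight p μ N x ∂μ = 1 / 2 := by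
    obtain ⟨g, hg⟩ := exists_clm_eq_setIntegral_mul hw (by norm_num) hK Set.univ
    rw [← hg]
    refine hcl g _ (Eventually.of_forall fun K => ?_)
    rw [hg, Measure.restrict_univ, integral_congr_ae (hFw K),
      integral_indicator (hN (measurableSet_singleton _)), setIntegral_const, smul_eq_mul,
      mul_div_assoc', mul_inv_cancel₀ (hkpos K).ne']
  -- The sets `{N ≤ j}` exhaust the space, so the integrals over them, all 0 since `k K ≥ K > j`
  -- eventually, would have to tend to 1/2.
  have hlim := tendsto_setIntegral_of_monotone (μ := μ) (s := fun j : ℕ => N ⁻¹' Set.Iic j)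
    (f := fun x => (a : X →ₘ[μ] ℝ) x * levelWeight p μ N x)
    (fun j => hN measurableSet_Iic)
    (fun i j hij => Set.preimage_mono (Set.Iic_subset_Iic.2 hij))
    (integrable_mul_of_lintegral_le hw (by norm_num) hK a).integrableOn
  have hunion : ⋃ j : ℕ, N ⁻¹' Set.Iic j = Set.univ :=
    Set.eq_univ_of_forall fun x => Set.mem_iUnion.2 ⟨N x, le_refl (N x)⟩
  rw [hunion, hhalf] at hlim
  have hz : ∀ j : ℕ, ∫ x in N ⁻¹' Set.Iic j, (a : X →ₘ[μ] ℝ) x * levelWeight p μ N x ∂μ = 0 :=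
    fun j => hreal _ <| by
      filter_upwards [eventually_gt_atTop j] with K hK x hx
      have hx' : N x ≤ j := hx
      have := hkK K
      omega
  simp only [hz] at hlim
  exact absurd (tendsto_nhds_unique hlim tendsto_const_nhds) (by norm_num)

theorem not_isRelWeaklyCompact_closedBall (h1 : ∀ᵐ x ∂μ, 1 < p x)
    (hlow : ∀ ε : ℝ, 0 < ε → ¬ ∀ᵐ x ∂μ, 1 + ε ≤ p x) :
    ¬ IsRelWeaklyCompact (Metric.closedBall (0 : varLp p μ) 1) := by
  have hN : Measurable fun x => ⌊(p x - 1)⁻¹⌋₊ :=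
    Nat.measurable_floor.comp (p.measurable'.sub_const 1).inv
  refine not_isRelWeaklyCompact_closedBall_of_level hN ?_ fun K => ?_
  · filter_upwards [h1] with x hx
    refine ⟨hx, ?_⟩
    have hx1 : 0 < p x - 1 := sub_pos.2 hx
    rw [← le_div_iff₀ hx1, one_div]
    exact Nat.floor_le (by positivity)
  · by_contra! hcon
    have h : ∀ᵐ k ∂μ.map (fun x => ⌊(p x - 1)⁻¹⌋₊), k < K := by
      rw [ae_iff_of_countable]
      intro k hk
      rw [Measure.map_apply hN (measurableSet_singleton k)] at hk
      by_contra hkK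
      exact hk (hcon k (not_lt.1 hkK))
    -- If no level from `K` on had mass, `1 / (p - 1) < K` a.e. would keep `p` away from 1. Using `K
    -- + 1` keeps the constant positive even for `K = 0`.
    refine hlow (K + 1 : ℝ)⁻¹ (by positivity) ?_
    filter_upwards [h1, ae_of_ae_map hN.aemeasurable h] with x hx hxK
    have hx1 : 0 < p x - 1 := sub_pos.2 hx
    have h3 : (p x - 1)⁻¹ < K := (Nat.floor_lt' (by omega)).1 hxK
    have h4 : (K + 1 : ℝ)⁻¹ ≤ p x - 1 :=
      inv_le_of_inv_le₀ hx1 (h3.le.trans (by linarith))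
    linarith

end Nonreflexive

/-! ### Failure of weak compactness and the main theorem -/

theorem VarExponent.not_ae_one_add_le_of_lower_eq_one {X : Type*} [MeasurableSpace X]
    {p : VarExponent X} {μ : Measure X} (h : p.lower μ = 1) {ε : ℝ} (hε : 0 < ε) :
    ¬ ∀ᵐ x ∂μ, 1 + ε ≤ p x := by
  intro hae
  have h1 : ENNReal.ofReal (1 + ε) ≤ p.lower μ :=
    le_essInf_of_ae_le _ (hae.mono fun x hx => ENNReal.ofReal_le_ofReal hx)
  rw [h, ENNReal.ofReal_le_one] at h1
  linarith

theorem not_isWeaklyCompactOp_compOp {X : Type*} [MeasurableSpace X] {p : VarExponent X}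
    {μ : Measure X} [IsFiniteMeasure μ] {φ : X → X} {hφ : Measure.QuasiMeasurePreserving φ μ μ}
    (h : CompMaps p μ hφ) (hone : μ p.omegaOne = 0) (hlow : p.lower μ = 1)
    (hu : 0 < essInf (rnComp μ φ) (μ.restrict p.omegaOneᶜ)) :
    ¬ IsWeaklyCompactOp (compOp p μ hφ h) := by
  intro hT
  have hrestrict : μ.restrict p.omegaOneᶜ = μ :=
    Measure.restrict_eq_self_of_ae_mem (measure_eq_zero_iff_ae_notMem.1 hone)
  rw [hrestrict] at hu
  -- The minimum with 1 makes `c` finite and less than 1, as the bound from below requires.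
  obtain ⟨c, hc0, hc, hclt⟩ := ENNReal.lt_iff_exists_real_btwn.1 (lt_min hu one_pos)
  have hcpos : 0 < c := ENNReal.ofReal_pos.1 hc
  have hc1 : c < 1 := ENNReal.ofReal_lt_one.1 (hclt.trans_le (min_le_right _ _))
  have hcu : ∀ᵐ x ∂μ, ENNReal.ofReal c ≤ rnComp μ φ x :=
    (ae_lt_of_lt_essInf (hclt.trans_le (min_le_left _ _))).mono fun x hx => hx.le
  have hid : IsWeaklyCompactOp (LinearMap.id : varLp p μ →ₗ[ℝ] varLp p μ) :=
    hT.of_norm_le (norm_le_mul_norm_compOp h hcpos hc1 hcu)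
  unfold IsWeaklyCompactOp at hid
  rw [LinearMap.id_coe, Set.image_id] at hid
  refine not_isRelWeaklyCompact_closedBall ?_
    (fun ε hε => VarExponent.not_ae_one_add_le_of_lower_eq_one hlow hε) hid
  filter_upwards [measure_eq_zero_iff_ae_notMem.1 hone] with x hx
  exact lt_of_le_of_ne (p.one_le' x) (Ne.symm hx)

end VariableLebesgue

theorem theorem4p5 (r : VariableLebesgue.VarExponent unitInterval)
    (hr_upper : r.upper volume < ∞)
    (hr_one : (volume : Measure unitInterval) r.omegaOne = 0)
    (φ : unitInterval → unitInterval)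
    (hφ : Measure.QuasiMeasurePreserving φ volume volume)
    (hT : VariableLebesgue.CompMaps r volume hφ) :
    (∀ S : Set (VariableLebesgue.varLp r (volume : Measure unitInterval)),
      VariableLebesgue.IsRelWeaklyCompact S →
        VariableLebesgue.IsRelWeaklyCompact (VariableLebesgue.compOp r volume hφ hT '' S)) ∧
    (∃ hM : VariableLebesgue.MulMaps r volume (VariableLebesgue.symbolComp r volume φ),
      (VariableLebesgue.IsWeaklyCompactOp (VariableLebesgue.compOp r volume hφ hT) ↔
        VariableLebesgue.IsWeaklyCompactOp
          (VariableLebesgue.mulOp r volume (VariableLebesgue.symbolComp r volume φ) hM))) ∧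
    (r.lower volume = 1 →
      0 < essInf (VariableLebesgue.rnComp volume φ)
        ((volume : Measure unitInterval).restrict r.omegaOneᶜ) →
      ¬ VariableLebesgue.IsWeaklyCompactOp (VariableLebesgue.compOp r volume hφ hT)) := by
  have hM := hT.mulMaps
  have hnorm := VariableLebesgue.norm_mulOp_symbolComp hT hM
  refine ⟨fun S hS => hS.image ⟨_, VariableLebesgue.continuous_compOp hT⟩, ⟨hM, ?_, ?_⟩,
    VariableLebesgue.not_isWeaklyCompactOp_compOp hT hr_one⟩
  · exact fun h => h.of_norm_le (C := 1) fun f => by rw [one_mul, hnorm]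
  · exact fun h => h.of_norm_le (C := 1) fun f => by rw [one_mul, hnorm]
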